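/- Let $A^+$ and $A^*$ denote the free semigroup and the free monoid on a finite set $A$. A subset of a semigroup is \emph{rational} if it is obtained from finite subsets by finitely many operations of union, product and generation of subsemigroups $E\mapsto E^+=\bigcup_{n\ge 1}E^n$. A \emph{rational language} is a rational subset of $A^*$, and a \emph{rational relation} is a rational subset of the monoid $A^*\times A^*$. A semigroup $S$ is \emph{quasi-automatic} if there are a finite generating set $A\subseteq S$, with canonical homomorphism $\mu:A^+\to S$, a rational language $L\subseteq A^+$ and rational relations $R,R_a\subseteq A^+\times A^+$ ($a\in A$) such that 1. $\mu(L)=S$; 2. $R=\{(u,v)\in L\times L : \mu(u)=\mu(v)\}$; 3. $R_a=\{(u,v)\in L\times L : \mu(ua)=\mu(v)\}$ for each $a\in A$. **Theorem.** Let $S$ be a quasi-automatic semigroup. Then the word problem of $S$, with respect to any finite generating family $g:X\to S$, is decidable in exponential time: there are a Turing machine (with finitely many stacks as storage) and constants $C,N\in\mathbb N$ such that, for all words $u,v\in X^+$, the machine started on the string $u\#v$ of length $n=|u|+|v|+1$ halts after at most $C\,N^{n}$ steps and outputs whether $u$ and $v$ represent the same element of $S$. -/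

import Mathlib

open scoped Pointwise

/-- Rational subsets of a semigroup: the smallest class that contains the finite subsets and is
closed under union, product and generation of subsemigroups (`E⁺ = E ∪ E² ∪ E³ ∪ …`). In a monoid
this is the same class as the one obtained with generation of submonoids, because `{1}` is
finite. -/
inductive IsRationalSubset {M : Type*} [Semigroup M] : Set M → Prop
  | finite (E : Set M) : E.Finite → IsRationalSubset E
  | union (E F : Set M) : IsRationalSubset E → IsRationalSubset F → IsRationalSubset (E ∪ F)
  | mul (E F : Set M) : IsRationalSubset E → IsRationalSubset F → IsRationalSubset (E * F)
  | plus (E : Set M) : IsRationalSubset E →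
      IsRationalSubset (Subsemigroup.closure E : Set M)

/-- `L ⊆ A⁺` is a rational language: a rational subset of the free monoid `A*`. -/
def IsRationalLanguage {A : Type*} (L : Set (FreeSemigroup A)) : Prop :=
  IsRationalSubset (FreeSemigroup.toFreeMonoid '' L)

/-- `R ⊆ A⁺ × A⁺` is a rational relation: a rational subset of the monoid `A* × A*`. -/
def IsRationalRelation {A : Type*} (R : Set (FreeSemigroup A × FreeSemigroup A)) : Prop :=
  IsRationalSubset
    (Prod.map FreeSemigroup.toFreeMonoid FreeSemigroup.toFreeMonoid '' R)

/-- A quasi-automatic semigroup structure on `S`. The canonical homomorphism `μ : A⁺ → S` is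
`FreeSemigroup.lift Subtype.val`. -/
structure QuasiAutomaticStructure (S : Type*) [Semigroup S] where
  /-- the finite generating set -/
  A : Finset S
  generates : Subsemigroup.closure (A : Set S) = ⊤
  /-- the language of representatives -/
  L : Set (FreeSemigroup A)
  /-- the equality relation on representatives -/
  R : Set (FreeSemigroup A × FreeSemigroup A)
  /-- the relations of right multiplication by the generators -/
  Rgen : A → Set (FreeSemigroup A × FreeSemigroup A)
  rational_L : IsRationalLanguage L
  rational_R : IsRationalRelation R
  rational_Rgen : ∀ a, IsRationalRelation (Rgen a)
  image_L : FreeSemigroup.lift (Subtype.val : A → S) '' L = Set.univ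
  R_eq : R = {p | p.1 ∈ L ∧ p.2 ∈ L ∧
    FreeSemigroup.lift (Subtype.val : A → S) p.1 = FreeSemigroup.lift (Subtype.val : A → S) p.2}
  Rgen_eq : ∀ a, Rgen a = {p | p.1 ∈ L ∧ p.2 ∈ L ∧
    FreeSemigroup.lift (Subtype.val : A → S) (p.1 * FreeSemigroup.of a) =
      FreeSemigroup.lift (Subtype.val : A → S) p.2}

/-- `S` is a quasi-automatic semigroup. -/
def IsQuasiAutomatic (S : Type*) [Semigroup S] : Prop :=
  Nonempty (QuasiAutomaticStructure S)

/-- The pair of words `(u, v)` written as the string `u # v`, with `# = none`. -/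
def encodeWordPair {X : Type} (p : FreeSemigroup X × FreeSemigroup X) : List (Option X) :=
  (p.1.head :: p.1.tail).map some ++ none :: (p.2.head :: p.2.tail).map some

open Classical in
/-- The predicate `P`, on instances `a` written as strings `enc a`, is decided in exponential time:
a multi-stack Turing machine decides `P a` within `C * N ^ n` steps, where `n` is the length of
`enc a`. -/
def DecidableInExpTime {α Γ : Type} (enc : α → List Γ) (P : α → Prop) : Prop :=
  ∃ (M : Turing.TM2ComputableInTime enc Computability.encodeBool (fun a => decide (P a)))
    (C N : ℕ), ∀ n, M.time n ≤ C * N ^ n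

/-- Equality in `S` of two words over an alphabet `X` of generators of `S`: the word problem of
`S` with respect to `g : X → S`. -/
def WordProblem {S : Type*} [Semigroup S] {X : Type} (g : X → S)
    (p : FreeSemigroup X × FreeSemigroup X) : Prop :=
  FreeSemigroup.lift g p.1 = FreeSemigroup.lift g p.2

/-! Right multiplication by a generator relates words of `L` through a rational relation, and a
rational relation is accepted by a two-tape automaton: a finite automaton that reads some
interleaving of the two words. Such a relation contains a function with the same domain that two
sweeps compute (`DFA.relates_transduce`). A right-to-left sweep records from which states the rest
of the input can still be completed; a left-to-right sweep then follows an accepting path and writes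
a block chosen in advance at each letter. As there are finitely many blocks, one generator
multiplies the length of the representative by at most a constant. Starting from a fixed
representative of the first generator, one thus obtains words of `L` for `u` and `v` with lengths
exponential in `|u|` and `|v|`, in exponential time.

The two words are compared through the relation `R`. The table of the states reachable after a
prefix of each word satisfies a local recurrence (`DFA.reach_append_append`), and it is filled row
by row: one sweep over the second word for each letter of the first. These sweeps do not lengthen
the word, so the comparison costs about the product of two exponential lengths, which is still
exponential (`SweepProgram.within_later`).

Both phases are sweeps, so a single stack machine executes them, and its time analysis is separate
from the semigroup (`SweepProgram.decidableInExpTime`, `Computes.decidableInExpTime`). -/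

namespace Language

/-! ### Closure properties of regular languages, by counting left quotients -/

variable {α : Type*}

/-- Every left quotient consists of suffixes of words of `L`, hence is a subset of one finite set.
-/
theorem isRegular_of_finite {L : Language α} (h : Set.Finite (L : Set (List α))) :
    L.IsRegular := by
  refine .of_finite_range_leftQuotient ?_
  have hs : {y : List α | ∃ z ∈ (L : Set (List α)), y <:+ z}.Finite := by
    have : {y : List α | ∃ z ∈ (L : Set (List α)), y <:+ z} =
        ⋃ z ∈ (L : Set (List α)), {y | y ∈ z.tails} := by
      ext y; simp
    rw [this]
    exact h.biUnion fun z _ => List.finite_toSet _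
  refine hs.finite_subsets.subset ?_
  rintro _ ⟨x, rfl⟩ y hy
  exact ⟨x ++ y, hy, List.suffix_append _ _⟩

/-- The quotient of `L * M` by `x` is `(x⁻¹L) * M` together with the sets `x₂⁻¹M` for the
factorizations `x = x₁x₂` with `x₁ ∈ L`. It is determined by one quotient of `L` and a set of
quotients of `M`, so there are finitely many. -/
theorem IsRegular.mul {L M : Language α} (hL : L.IsRegular) (hM : M.IsRegular) :
    (L * M).IsRegular := by
  refine .of_finite_range_leftQuotient ?_
  refine ((hL.finite_range_leftQuotient.prod hM.finite_range_leftQuotient.finite_subsets).image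
    fun p : Language α × Set (Language α) =>
      (((p.1 * M : Language α) : Set (List α)) ∪ {y | ∃ N ∈ p.2, y ∈ N} : Set (List α))).subset ?_
  rintro _ ⟨x, rfl⟩
  refine ⟨⟨L.leftQuotient x, {N | ∃ x₁ ∈ L, ∃ x₂, x₁ ++ x₂ = x ∧ N = M.leftQuotient x₂}⟩,
    ⟨⟨x, rfl⟩, ?_⟩, ?_⟩
  · rintro _ ⟨_, _, x₂, _, rfl⟩
    exact ⟨x₂, rfl⟩
  · ext y
    change (y ∈ leftQuotient L x * M ∨ _) ↔ _
    rw [mem_mul]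
    constructor
    · rintro (⟨a, ha, b, hb, rfl⟩ | ⟨_, ⟨x₁, h₁, x₂, rfl, rfl⟩, h⟩)
      · exact ⟨x ++ a, ha, b, hb, by simp⟩
      · exact ⟨x₁, h₁, x₂ ++ y, h, by simp⟩
    · rintro ⟨a, ha, b, hb, hab⟩
      rcases List.append_eq_append_iff.1 hab with ⟨c, rfl, rfl⟩ | ⟨c, rfl, rfl⟩
      · exact Or.inr ⟨_, ⟨a, ha, c, rfl, rfl⟩, hb⟩
      · exact Or.inl ⟨c, ha, b, hb, rfl⟩

/-- A factorization of a product of words of `L` around a cut. -/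
theorem exists_split_of_mem_closure {L : Set (FreeMonoid α)} {z : FreeMonoid α}
    (hz : z ∈ Subsemigroup.closure L) : ∀ x y : FreeMonoid α, x * y = z →
      ∃ x₁ x₂ y₁ y₂ : FreeMonoid α, x₁ * x₂ = x ∧ y₁ * y₂ = y ∧ x₂ * y₁ ∈ L ∧
        (x₁ = 1 ∨ x₁ ∈ Subsemigroup.closure L) ∧ (y₂ = 1 ∨ y₂ ∈ Subsemigroup.closure L) := by
  induction hz using Subsemigroup.closure_induction with
  | mem z hz =>
    rintro x y rfl
    exact ⟨1, x, y, 1, one_mul _, mul_one _, hz, Or.inl rfl, Or.inl rfl⟩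
  | mul a b ha hb iha ihb =>
    intro x y h
    rcases List.append_eq_append_iff.1 h with ⟨c, h₁, h₂⟩ | ⟨c, h₁, h₂⟩
    · obtain ⟨x₁, x₂, y₁, y₂, e₁, e₂, hm, hx, hy⟩ := iha x c h₁.symm
      refine ⟨x₁, x₂, y₁, y₂ * b, e₁, ?_, hm, hx, Or.inr ?_⟩
      · rw [← mul_assoc, e₂]; exact h₂.symm
      · rcases hy with rfl | hy
        · rwa [one_mul]
        · exact mul_mem hy hb
    · obtain ⟨x₁, x₂, y₁, y₂, e₁, e₂, hm, hx, hy⟩ := ihb c y h₂.symm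
      refine ⟨a * x₁, x₂, y₁, y₂, ?_, e₂, hm, Or.inr ?_, hy⟩
      · rw [mul_assoc, e₁]; exact h₁.symm
      · rcases hx with rfl | hx
        · rwa [mul_one]
        · exact mul_mem ha hx

/-- A cut between `x` and `y` falls in a single factor from `L`. Hence the quotient by `x` depends
only on the set of quotients `x₂⁻¹L`, where `x = x₁x₂` and `x₁` is empty or a product of words of
`L`. -/
theorem IsRegular.subsemigroupClosure {L : Set (FreeMonoid α)}
    (hL : IsRegular (L : Language α)) :
    IsRegular ((Subsemigroup.closure L : Set (FreeMonoid α)) : Language α) := by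
  refine .of_finite_range_leftQuotient ?_
  refine (hL.finite_range_leftQuotient.finite_subsets.image
    fun T : Set (Language α) => ({y : FreeMonoid α | ∃ N ∈ T, ∃ y₁ y₂ : FreeMonoid α,
      y₁ * y₂ = y ∧ y₁ ∈ (N : Set (FreeMonoid α)) ∧
        (y₂ = 1 ∨ y₂ ∈ Subsemigroup.closure L)} : Set (FreeMonoid α))).subset ?_
  rintro _ ⟨x, rfl⟩
  refine ⟨{N | ∃ x₁ x₂ : FreeMonoid α, x₁ * x₂ = x ∧ (x₁ = 1 ∨ x₁ ∈ Subsemigroup.closure L) ∧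
    N = leftQuotient (L : Language α) x₂}, ?_, ?_⟩
  · rintro _ ⟨_, x₂, _, _, rfl⟩
    exact ⟨x₂, rfl⟩
  · refine Set.ext fun y => ⟨?_, fun hy => ?_⟩
    · rintro ⟨_, ⟨x₁, x₂, rfl, hx, rfl⟩, y₁, y₂, rfl, hm, hy⟩
      change (x₁ * x₂) * (y₁ * y₂) ∈ Subsemigroup.closure L
      have hm' : x₂ * y₁ ∈ Subsemigroup.closure L := Subsemigroup.subset_closure hm
      have hl : x₁ * (x₂ * y₁) ∈ Subsemigroup.closure L := by
        rcases hx with rfl | hx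
        · rwa [one_mul]
        · exact mul_mem hx hm'
      have e : (x₁ * x₂) * (y₁ * y₂) = (x₁ * (x₂ * y₁)) * y₂ := by simp only [mul_assoc]
      rw [e]
      rcases hy with rfl | hy
      · rwa [mul_one]
      · exact mul_mem hl hy
    · obtain ⟨x₁, x₂, y₁, y₂, e₁, e₂, hm, hx, hy⟩ :=
        exists_split_of_mem_closure (L := L) (z := FreeMonoid.ofList x * y) hy _ _ rfl
      exact ⟨_, ⟨x₁, x₂, e₁, hx, rfl⟩, y₁, y₂, e₂, hm, hy⟩

end Language

/-- Rational subsets of a quotient of a free monoid are images of regular languages. -/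
theorem IsRationalSubset.exists_isRegular {α M : Type*} [Monoid M] (φ : FreeMonoid α →* M)
    (hφ : Function.Surjective φ) {E : Set M} (hE : IsRationalSubset E) :
    ∃ K : Set (FreeMonoid α), Language.IsRegular (K : Language α) ∧ φ '' K = E := by
  induction hE with
  | finite E hE =>
    choose f hf using hφ
    refine ⟨f '' E, Language.isRegular_of_finite (hE.image f), ?_⟩
    rw [Set.image_image]
    simp [hf]
  | union E F _ _ ihE ihF =>
    obtain ⟨K, hK, rfl⟩ := ihE
    obtain ⟨K', hK', rfl⟩ := ihF
    exact ⟨K ∪ K', hK.add hK', Set.image_union _ _ _⟩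
  | mul E F _ _ ihE ihF =>
    obtain ⟨K, hK, rfl⟩ := ihE
    obtain ⟨K', hK', rfl⟩ := ihF
    exact ⟨K * K', hK.mul hK', Set.image_mul φ⟩
  | plus E _ ih =>
    obtain ⟨K, hK, rfl⟩ := ih
    refine ⟨Subsemigroup.closure K, hK.subsemigroupClosure, ?_⟩
    have := MulHom.map_mclosure (φ : FreeMonoid α →ₙ* M) K
    exact congrArg (fun T : Subsemigroup M => (T : Set M)) this

/-! ### Sweep programs and the stack machine that executes them -/

/-- A program that rewrites a word by commands. A command is a sweep from right to left, by a finite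
automaton with states `β`, followed by a sweep from left to right, by a transducer with states `ρ`
that also reads the states of the first sweep. The input letter `x` stands for the commands
`word x`; the word computed from the first half of the input is itself turned into commands. -/
structure SweepProgram (X : Type) where
  Γ : Type
  Cmd : Type
  β : Type
  ρ : Type
  word : X → List Cmd
  mark : Cmd
  comp : Γ → Cmd
  backInit : Cmd → β
  backStep : Cmd → Γ → β → β
  fwdInit : Cmd → β → ρ
  fwdStep : Cmd → ρ → Γ → β → ρ × List Γ
  fwdEnd : Cmd → ρ → List Γ
  accept : Option Γ → Bool

namespace SweepProgram

variable {X : Type} (P : SweepProgram X)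

/-- The state of the right-to-left sweep after a suffix. -/
def back (c : P.Cmd) (l : List P.Γ) : P.β :=
  l.foldr (P.backStep c) (P.backInit c)

/-- The output of the left-to-right sweep over a suffix. -/
def fwd (c : P.Cmd) : P.ρ → List P.Γ → List P.Γ
  | r, [] => P.fwdEnd c r
  | r, γ :: l => (P.fwdStep c r γ (P.back c l)).2 ++ fwd c (P.fwdStep c r γ (P.back c l)).1 l

/-- The effect of a command. -/
def run (l : List P.Γ) (c : P.Cmd) : List P.Γ :=
  P.fwd c (P.fwdInit c (P.back c l)) l

/-- The word computed from an input word. -/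
def eval (u : List X) : List P.Γ :=
  (u.flatMap P.word).foldl P.run []

/-- The answer of the program to the input `u # v`. -/
def answer (u v : List X) : Bool :=
  P.accept (((P.eval u).map P.comp).foldl P.run (P.run (P.eval v) P.mark)).getLast?

/-- The stacks of the machine. -/
inductive Stack
  | inp | out | todo | later | left | right
  deriving DecidableEq

instance : Fintype Stack where
  elems := {.inp, .out, .todo, .later, .left, .right}
  complete k := by cases k <;> decide

/-- The labels of the machine. -/
inductive Label (Cmd β ρ : Type)
  | idle : Label Cmd β ρ
  | back : Cmd → β → Label Cmd β ρ
  | fwd : Cmd → ρ → Label Cmd β ρ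
  | move : Label Cmd β ρ
  | clear : Bool → Label Cmd β ρ
  deriving Fintype

/-- The alphabets of the stacks. -/
abbrev Sym : Stack → Type
  | .inp => Option X
  | .out => Bool
  | .todo => P.Cmd
  | .later => P.Cmd
  | .left => P.Γ
  | .right => P.Γ × P.β

/-- The registers of the machine: the symbols read last. -/
abbrev Reg : Type :=
  Option (Option X) × Option P.Cmd × Option P.Γ × Option (P.Γ × P.β)

/-- The label that starts the command in the register. -/
def startLabel (v : P.Reg) : Label P.Cmd P.β P.ρ :=
  match v.2.1 with
  | some c => .back c (P.backInit c)
  | none => .idle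

/-- The contents of the stacks. -/
def store (i : List (Option X)) (o : List Bool) (t d : List P.Cmd) (w : List P.Γ)
    (v : List (P.Γ × P.β)) : ∀ k, List (P.Sym k)
  | .inp => i
  | .out => o
  | .todo => t
  | .later => d
  | .left => w
  | .right => v

section store
variable (i i' : List (Option X)) (o o' : List Bool) (t t' d d' : List P.Cmd) (w w' : List P.Γ)
    (v v' : List (P.Γ × P.β))

@[simp] theorem update_store_inp : Function.update (P.store i o t d w v) .inp i' =
    P.store i' o t d w v := by
  funext k; cases k <;> rfl

@[simp] theorem update_store_out : Function.update (P.store i o t d w v) .out o' =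
    P.store i o' t d w v := by
  funext k; cases k <;> rfl

@[simp] theorem update_store_todo : Function.update (P.store i o t d w v) .todo t' =
    P.store i o t' d w v := by
  funext k; cases k <;> rfl

@[simp] theorem update_store_later : Function.update (P.store i o t d w v) .later d' =
    P.store i o t d' w v := by
  funext k; cases k <;> rfl

@[simp] theorem update_store_left : Function.update (P.store i o t d w v) .left w' =
    P.store i o t d w' v := by
  funext k; cases k <;> rfl

@[simp] theorem update_store_right : Function.update (P.store i o t d w v) .right v' =
    P.store i o t d w v' := by
  funext k; cases k <;> rfl

end store

end SweepProgram

namespace Turing.TM2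

variable {K : Type*} {Γ : K → Type*} {Λ σ : Type*}

/-- Push the first `n` letters of a word that depends on the internal state. -/
def pushList (k : K) (d : Γ k) (f : σ → List (Γ k)) : ℕ → Stmt Γ Λ σ → Stmt Γ Λ σ
  | 0, q => q
  | n + 1, q => .branch (fun v => decide (n < (f v).length))
      (.push k (fun v => (f v).getD n d) (pushList k d f n q)) (pushList k d f n q)

/-- A statement contains no loop, so the number of pushes is a fixed bound and each push is guarded
by the actual length. The index decreases, which leaves the first letter on top. -/
theorem stepAux_pushList [DecidableEq K] (k : K) (d : Γ k) (f : σ → List (Γ k)) (n : ℕ)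
    (q : Stmt Γ Λ σ) (v : σ) (S : ∀ k, List (Γ k)) :
    stepAux (pushList k d f n q) v S =
      stepAux q v (Function.update S k ((f v).take n ++ S k)) := by
  induction n generalizing S with
  | zero => simp [pushList]
  | succ n ih =>
    by_cases h : n < (f v).length
    · simp only [pushList, stepAux, h, decide_true, cond_true, ih, Function.update_self,
        Function.update_idem, List.getD_eq_getElem]
      rw [List.take_succ_eq_append_getElem h, List.append_assoc]
      rfl
    · simp only [pushList, stepAux, h, decide_false, cond_false, ih]
      rw [List.take_of_length_le (by omega), List.take_of_length_le (by omega)]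

end Turing.TM2

namespace SweepProgram

open Turing Turing.TM2

variable {X : Type} (P : SweepProgram X) [Inhabited P.Γ] (B : ℕ)

/-- The statements of the machine. -/
def stmt : Label P.Cmd P.β P.ρ → Stmt P.Sym (Label P.Cmd P.β P.ρ) P.Reg
  | .idle =>
    .pop .todo (fun v o => (v.1, o, v.2.2)) <|
    .branch (fun v => v.2.1.isSome) (.goto P.startLabel) <|
    .pop .inp (fun v o => (o, v.2)) <|
    .branch (fun v => v.1.isSome)
      (.branch (fun v => (v.1.getD none).isSome)
        (pushList .todo P.mark (fun v => ((v.1.getD none).map P.word).getD []) B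
          (.goto fun _ => .idle))
        (.goto fun _ => .move)) <|
    .pop .later (fun v o => (v.1, o, v.2.2)) <|
    .branch (fun v => v.2.1.isSome) (.goto P.startLabel) <|
    .peek .left (fun v o => (v.1, v.2.1, o, v.2.2.2)) <|
    .goto fun v => .clear (P.accept v.2.2.1)
  | .back c b =>
    .pop .left (fun v o => (v.1, v.2.1, o, v.2.2.2)) <|
    .branch (fun v => v.2.2.1.isSome)
      (.push .right (fun v => (v.2.2.1.getD default, b)) <|
        .goto fun v => .back c (P.backStep c (v.2.2.1.getD default) b))
      (.goto fun _ => .fwd c (P.fwdInit c b))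
  | .fwd c r =>
    .pop .right (fun v o => (v.1, v.2.1, v.2.2.1, o)) <|
    .branch (fun v => v.2.2.2.isSome)
      (pushList .left (default : P.Γ)
        (fun v => ((v.2.2.2.map fun p => (P.fwdStep c r p.1 p.2).2).getD []).reverse) B <|
        .goto fun v => ((v.2.2.2.map fun p => .fwd c (P.fwdStep c r p.1 p.2).1).getD .idle))
      (pushList .left (default : P.Γ) (fun _ => (P.fwdEnd c r).reverse) B <|
        .goto fun _ => .idle)
  | .move =>
    .pop .left (fun v o => (v.1, v.2.1, o, v.2.2.2)) <|
    .branch (fun v => v.2.2.1.isSome)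
      (.push .later (fun v => P.comp (v.2.2.1.getD default)) <| .goto fun _ => .move)
      (.push .later (fun _ => P.mark) <| .goto fun _ => .idle)
  | .clear b =>
    .pop .left (fun v o => (v.1, v.2.1, o, v.2.2.2)) <|
    .branch (fun v => v.2.2.1.isSome) (.goto fun _ => .clear b)
      -- A halting configuration must have the initial registers and no stack contents except the
      -- output.
      (.push .out (fun _ => b) <| .load (fun _ => (none, none, none, none)) .halt)

/-- The machine goes from one configuration to another in `n` steps, whatever is in its registers. -/
def Steps (n : ℕ) (l : Label P.Cmd P.β P.ρ) (S : ∀ k, List (P.Sym k))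
    (l' : Label P.Cmd P.β P.ρ) (S' : ∀ k, List (P.Sym k)) : Prop :=
  ∀ v, ∃ v', (flip bind (step (P.stmt B)))^[n] (some ⟨some l, v, S⟩) = some ⟨some l', v', S'⟩

variable {P B}

theorem Steps.trans {m n : ℕ} {l₁ l₂ l₃ : Label P.Cmd P.β P.ρ} {S₁ S₂ S₃ : ∀ k, List (P.Sym k)}
    (h₁ : P.Steps B m l₁ S₁ l₂ S₂) (h₂ : P.Steps B n l₂ S₂ l₃ S₃) :
    P.Steps B (n + m) l₁ S₁ l₃ S₃ := by
  intro v
  obtain ⟨v', h⟩ := h₁ v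
  obtain ⟨v'', h'⟩ := h₂ v'
  exact ⟨v'', by rw [Function.iterate_add_apply, h, h']⟩

theorem Steps.refl (l : Label P.Cmd P.β P.ρ) (S : ∀ k, List (P.Sym k)) :
    P.Steps B 0 l S l S :=
  fun v => ⟨v, rfl⟩

theorem Steps.single {l l' : Label P.Cmd P.β P.ρ} {S S' : ∀ k, List (P.Sym k)}
    (h : ∀ v, ∃ v', stepAux (P.stmt B l) v S = ⟨some l', v', S'⟩) : P.Steps B 1 l S l' S' := by
  intro v
  obtain ⟨v', h⟩ := h v
  exact ⟨v', congrArg some h⟩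

variable {i : List (Option X)} {o : List Bool} {t d : List P.Cmd} {w : List P.Γ}
    {v : List (P.Γ × P.β)}

theorem steps_idle_todo (c : P.Cmd) : P.Steps B 1 .idle (P.store i o (c :: t) d w v)
    (.back c (P.backInit c)) (P.store i o t d w v) :=
  .single fun r => ⟨_, by simp [stmt, store, startLabel]; rfl⟩

theorem steps_idle_letter (x : X) (hB : (P.word x).length ≤ B) :
    P.Steps B 1 .idle (P.store (some x :: i) o [] d w v)
      .idle (P.store i o (P.word x) d w v) :=
  .single fun r => ⟨_, by
    simp [stmt, store, stepAux_pushList, List.take_of_length_le hB]; rfl⟩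

theorem steps_idle_separator : P.Steps B 1 .idle (P.store (none :: i) o [] d w v)
    .move (P.store i o [] d w v) :=
  .single fun r => ⟨_, by simp [stmt, store]; rfl⟩

theorem steps_idle_later (c : P.Cmd) : P.Steps B 1 .idle (P.store [] o [] (c :: d) w v)
    (.back c (P.backInit c)) (P.store [] o [] d w v) :=
  .single fun r => ⟨_, by simp [stmt, store, startLabel]; rfl⟩

theorem steps_idle_clear : P.Steps B 1 .idle (P.store [] o [] [] w v)
    (.clear (P.accept w.head?)) (P.store [] o [] [] w v) :=
  .single fun r => ⟨_, by simp [stmt, store]; rfl⟩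

end SweepProgram

/-! ### Correctness and running time of the machine -/

namespace SweepProgram

open Turing Turing.TM2

variable {X : Type} {P : SweepProgram X} {B : ℕ}

/-- `B` bounds the lengths of the words that the program writes in one step. -/
structure Bounded (P : SweepProgram X) (B : ℕ) : Prop where
  word : ∀ x, (P.word x).length ≤ B
  fwdStep : ∀ c r γ b, (P.fwdStep c r γ b).2.length ≤ B
  fwdEnd : ∀ c r, (P.fwdEnd c r).length ≤ B

theorem exists_bounded [Finite X] [Finite P.Γ] [Finite P.Cmd] [Finite P.β] [Finite P.ρ] :
    ∃ B, P.Bounded B := by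
  obtain ⟨B₁, h₁⟩ := (Set.finite_range fun x => (P.word x).length).bddAbove
  obtain ⟨B₂, h₂⟩ := (Set.finite_range fun q : P.Cmd × P.ρ × P.Γ × P.β =>
    (P.fwdStep q.1 q.2.1 q.2.2.1 q.2.2.2).2.length).bddAbove
  obtain ⟨B₃, h₃⟩ := (Set.finite_range fun q : P.Cmd × P.ρ =>
    (P.fwdEnd q.1 q.2).length).bddAbove
  refine ⟨B₁ + B₂ + B₃, fun x => ?_, fun c r γ b => ?_, fun c r => ?_⟩
  · have := h₁ ⟨x, rfl⟩
    dsimp only at this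
    omega
  · have := h₂ ⟨(c, r, γ, b), rfl⟩
    dsimp only at this
    omega
  · have := h₃ ⟨(c, r), rfl⟩
    dsimp only at this
    omega

/-- Each letter and the end of the word contribute at most `B` letters. Counting lengths plus one
makes the bound purely multiplicative, so that it iterates. -/
theorem length_run_le (hP : P.Bounded B) (l : List P.Γ) (c : P.Cmd) :
    (P.run l c).length + 1 ≤ (B + 1) * (l.length + 1) := by
  have key : ∀ (l : List P.Γ) (r : P.ρ), (P.fwd c r l).length ≤ B * (l.length + 1) := by
    intro l
    induction l with
    | nil => intro r; simpa [fwd] using hP.fwdEnd c r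
    | cons γ l ih =>
      intro r
      have h₁ := hP.fwdStep c r γ (P.back c l)
      have h₂ := ih (P.fwdStep c r γ (P.back c l)).1
      simp only [fwd, List.length_append, List.length_cons]
      nlinarith
  have := key l (P.fwdInit c (P.back c l))
  unfold run
  nlinarith

variable [Inhabited P.Γ]

section sweep

variable {i : List (Option X)} {o : List Bool} {t d : List P.Cmd} {w : List P.Γ}
    {v : List (P.Γ × P.β)}

theorem steps_back_cons (c : P.Cmd) (b : P.β) (γ : P.Γ) :
    P.Steps B 1 (.back c b) (P.store i o t d (γ :: w) v)
      (.back c (P.backStep c γ b)) (P.store i o t d w ((γ, b) :: v)) :=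
  .single fun r => ⟨_, by simp [stmt, store]; rfl⟩

theorem steps_back_nil (c : P.Cmd) (b : P.β) :
    P.Steps B 1 (.back c b) (P.store i o t d [] v)
      (.fwd c (P.fwdInit c b)) (P.store i o t d [] v) :=
  .single fun r => ⟨_, by simp [stmt, store]; rfl⟩

theorem steps_fwd_cons (c : P.Cmd) (r : P.ρ) (γ : P.Γ) (b : P.β)
    (hB : (P.fwdStep c r γ b).2.length ≤ B) :
    P.Steps B 1 (.fwd c r) (P.store i o t d w ((γ, b) :: v))
      (.fwd c (P.fwdStep c r γ b).1)
        (P.store i o t d ((P.fwdStep c r γ b).2.reverse ++ w) v) :=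
  .single fun r => ⟨_, by
    simp [stmt, store, stepAux_pushList, List.take_of_length_le, hB]; rfl⟩

theorem steps_fwd_nil (c : P.Cmd) (r : P.ρ) (hB : (P.fwdEnd c r).length ≤ B) :
    P.Steps B 1 (.fwd c r) (P.store i o t d w [])
      .idle (P.store i o t d ((P.fwdEnd c r).reverse ++ w) []) :=
  .single fun r => ⟨_, by
    simp [stmt, store, stepAux_pushList, List.take_of_length_le, hB]; rfl⟩

theorem steps_move_cons (γ : P.Γ) : P.Steps B 1 .move (P.store i o t d (γ :: w) v)
    .move (P.store i o t (P.comp γ :: d) w v) :=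
  .single fun r => ⟨_, by simp [stmt, store]; rfl⟩

theorem steps_move_nil : P.Steps B 1 .move (P.store i o t d [] v)
    .idle (P.store i o t (P.mark :: d) [] v) :=
  .single fun r => ⟨_, by simp [stmt, store]; rfl⟩

theorem steps_clear_cons (b : Bool) (γ : P.Γ) :
    P.Steps B 1 (.clear b) (P.store i o t d (γ :: w) v) (.clear b) (P.store i o t d w v) :=
  .single fun r => ⟨_, by simp [stmt, store]; rfl⟩

theorem stepAux_clear_nil (b : Bool) (r : P.Reg) :
    stepAux (P.stmt B (.clear b)) r (P.store i o t d [] v) =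
      ⟨none, (none, none, none, none), P.store i (b :: o) t d [] v⟩ := by
  simp [stmt, store]

end sweep

/-- The machine goes from one configuration to another in at most `n` steps. -/
def Within (P : SweepProgram X) [Inhabited P.Γ] (B n : ℕ) (l : Label P.Cmd P.β P.ρ)
    (S : ∀ k, List (P.Sym k)) (l' : Label P.Cmd P.β P.ρ) (S' : ∀ k, List (P.Sym k)) : Prop :=
  ∃ m ≤ n, P.Steps B m l S l' S'

theorem Steps.within {n : ℕ} {l l' : Label P.Cmd P.β P.ρ} {S S' : ∀ k, List (P.Sym k)}
    (h : P.Steps B n l S l' S') : P.Within B n l S l' S' :=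
  ⟨n, le_rfl, h⟩

theorem Within.mono {m n : ℕ} {l l' : Label P.Cmd P.β P.ρ} {S S' : ∀ k, List (P.Sym k)}
    (h : P.Within B m l S l' S') (hmn : m ≤ n) : P.Within B n l S l' S' :=
  let ⟨k, hk, hs⟩ := h
  ⟨k, hk.trans hmn, hs⟩

theorem Within.trans {m n : ℕ} {l₁ l₂ l₃ : Label P.Cmd P.β P.ρ}
    {S₁ S₂ S₃ : ∀ k, List (P.Sym k)} (h₁ : P.Within B m l₁ S₁ l₂ S₂)
    (h₂ : P.Within B n l₂ S₂ l₃ S₃) : P.Within B (m + n) l₁ S₁ l₃ S₃ :=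
  let ⟨j, hj, hs⟩ := h₁
  let ⟨k, hk, hs'⟩ := h₂
  ⟨k + j, by omega, hs.trans hs'⟩

/-- The letters of a word with the states of the right-to-left sweep. -/
def annotate (P : SweepProgram X) (c : P.Cmd) : List P.Γ → List (P.Γ × P.β)
  | [] => []
  | γ :: l => (γ, P.back c l) :: annotate P c l

/-- The stack `left` has the last letter of the word on top. In the middle of the sweep `p` is still
there, while `s` lies on `right`, each letter paired with the state of the sweep after the suffix
that follows it. -/
theorem within_back (c : P.Cmd) (i : List (Option X)) (o : List Bool) (t d : List P.Cmd)
    (p s : List P.Γ) :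
    P.Within B (p.length + 1) (.back c (P.back c s))
      (P.store i o t d p.reverse (P.annotate c s))
      (.fwd c (P.fwdInit c (P.back c (p ++ s))))
      (P.store i o t d [] (P.annotate c (p ++ s))) := by
  induction p using List.reverseRecOn generalizing s with
  | nil => exact (steps_back_nil c _).within
  | append_singleton p γ ih =>
    have h := ih (γ :: s)
    rw [List.reverse_append, List.append_assoc]
    exact ((steps_back_cons c _ γ).within.trans h).mono (by simp; omega)

theorem within_fwd (c : P.Cmd) (hs : ∀ r γ b, (P.fwdStep c r γ b).2.length ≤ B)
    (he : ∀ r, (P.fwdEnd c r).length ≤ B) (i : List (Option X)) (o : List Bool)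
    (t d : List P.Cmd) (w l : List P.Γ) (r : P.ρ) :
    P.Within B (l.length + 1) (.fwd c r) (P.store i o t d w (P.annotate c l))
      .idle (P.store i o t d ((P.fwd c r l).reverse ++ w) []) := by
  induction l generalizing r w with
  | nil => exact (steps_fwd_nil c r (he r)).within
  | cons γ l ih =>
    have h := ih ((P.fwdStep c r γ (P.back c l)).2.reverse ++ w)
      (P.fwdStep c r γ (P.back c l)).1
    rw [← List.append_assoc, ← List.reverse_append] at h
    exact ((steps_fwd_cons c r γ _ (hs _ _ _)).within.trans h).mono (by simp; omega)

theorem within_run (hP : P.Bounded B) (c : P.Cmd) (i : List (Option X)) (o : List Bool)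
    (t d : List P.Cmd) (l : List P.Γ) :
    P.Within B (2 * l.length + 2) (.back c (P.backInit c)) (P.store i o t d l.reverse [])
      .idle (P.store i o t d (P.run l c).reverse []) := by
  have h₁ := within_back (B := B) c i o t d l []
  have h₂ := within_fwd c (hP.fwdStep c) (hP.fwdEnd c) i o t d [] l
    (P.fwdInit c (P.back c l))
  rw [List.append_nil] at h₁ h₂
  exact (h₁.trans h₂).mono (by omega)

/-- A command multiplies the length plus one by at most `B + 1` and takes linear time. With base `B
+ 2`, the surplus `3 * (l.length + 1)` at each stage pays for that time. -/
theorem within_todo (hP : P.Bounded B) (i : List (Option X)) (o : List Bool) (t d : List P.Cmd) (l : List P.Γ) :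
    P.Within B (3 * (B + 2) ^ t.length * (l.length + 1)) .idle (P.store i o t d l.reverse [])
      .idle (P.store i o [] d (t.foldl P.run l).reverse []) ∧
    (t.foldl P.run l).length + 1 ≤ (B + 2) ^ t.length * (l.length + 1) := by
  induction t generalizing l with
  | nil => exact ⟨(Steps.refl _ _).within.mono (by omega), by simp⟩
  | cons c t ih =>
    obtain ⟨h₁, h₂⟩ := ih (P.run l c)
    have hr := length_run_le hP l c
    have hN : 1 ≤ (B + 2) ^ t.length := Nat.one_le_pow _ _ (by omega)
    have hm := Nat.mul_le_mul_left ((B + 2) ^ t.length) hr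
    have hs := Nat.mul_le_mul_right (l.length + 1) hN
    refine ⟨(((steps_idle_todo c).within.trans (within_run hP c i o t d l)).trans h₁).mono ?_,
      h₂.trans ?_⟩
    · rw [List.length_cons, pow_succ]
      nlinarith
    · rw [List.length_cons, pow_succ]
      nlinarith

/-- An input letter stands for at most `B` commands, so it multiplies lengths by at most `(B + 2) ^
B`. Adding one to this base again pays for the time. -/
theorem within_letters (hP : P.Bounded B) (u : List X) (i : List (Option X)) (o : List Bool) (d : List P.Cmd)
    (l : List P.Γ) :
    P.Within B (4 * (B + 2) ^ B * ((B + 2) ^ B + 1) ^ u.length * (l.length + 1))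
      .idle (P.store (u.map some ++ i) o [] d l.reverse [])
      .idle (P.store i o [] d ((u.flatMap P.word).foldl P.run l).reverse []) ∧
    ((u.flatMap P.word).foldl P.run l).length + 1 ≤
      ((B + 2) ^ B + 1) ^ u.length * (l.length + 1) := by
  induction u generalizing l with
  | nil => exact ⟨(Steps.refl _ _).within.mono (by omega), by simp⟩
  | cons x u ih =>
    obtain ⟨h₁, h₂⟩ := within_todo hP (u.map some ++ i) o (P.word x) d l
    have hpow : (B + 2) ^ (P.word x).length ≤ (B + 2) ^ B :=
      Nat.pow_le_pow_right (by omega) (hP.word x)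
    obtain ⟨h₃, h₄⟩ := ih ((P.word x).foldl P.run l)
    have h₂' := h₂.trans (Nat.mul_le_mul_right _ hpow)
    have hpow' := Nat.mul_le_mul_right (l.length + 1) hpow
    have hM : 1 ≤ (B + 2) ^ B := Nat.one_le_pow _ _ (by omega)
    simp only [List.flatMap_cons, List.foldl_append, List.map_cons, List.cons_append]
    rw [List.length_cons, pow_succ]
    generalize (B + 2) ^ B = M at *
    have hR : 1 ≤ (M + 1) ^ u.length := Nat.one_le_pow _ _ (by omega)
    generalize (M + 1) ^ u.length = R at *
    have hm := Nat.mul_le_mul_left R h₂'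
    have hs : M * (l.length + 1) ≤ R * (M * (l.length + 1)) := Nat.le_mul_of_pos_left _ hR
    have hs' : l.length + 1 ≤ M * (l.length + 1) := Nat.le_mul_of_pos_left _ hM
    refine ⟨(((steps_idle_letter x (hP.word x)).within.trans h₁).trans h₃).mono ?_,
      h₄.trans ?_⟩
    · have e₁ : 4 * M * R * ((P.word x |>.foldl P.run l).length + 1) ≤
          4 * M * (R * (M * (l.length + 1))) := by
        rw [mul_assoc (4 * M)]; exact Nat.mul_le_mul_left _ hm
      have e₂ : 4 * M * (l.length + 1) ≤ 4 * M * (R * (l.length + 1)) :=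
        Nat.mul_le_mul_left _ (Nat.le_mul_of_pos_left _ hR)
      have e₃ : 4 * M * (R * (M + 1)) * (l.length + 1) =
          4 * M * (R * (M * (l.length + 1))) + 4 * M * (R * (l.length + 1)) := by ring
      have e₄ : 3 * (B + 2) ^ (P.word x).length * (l.length + 1) ≤ 3 * (M * (l.length + 1)) := by
        rw [mul_assoc]; exact Nat.mul_le_mul_left _ hpow'
      have e₅ : 4 * M * (l.length + 1) = 3 * (M * (l.length + 1)) + M * (l.length + 1) := by ring
      omega
    · have e : R * (M + 1) * (l.length + 1) = R * (M * (l.length + 1)) + R * (l.length + 1) := by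
        ring
      omega

/-- The number of commands is itself exponential here, so any growth per command could give a doubly
exponential time. As no command lengthens the word, the cost is only a product. -/
theorem within_later (hP : P.Bounded B) (o : List Bool) (t : List P.Cmd) (l : List P.Γ)
    (ht : ∀ c ∈ t, ∀ l, (P.run l c).length ≤ l.length) :
    P.Within B (t.length * (2 * l.length + 3)) .idle (P.store [] o [] t l.reverse [])
      .idle (P.store [] o [] [] (t.foldl P.run l).reverse []) ∧
    (t.foldl P.run l).length ≤ l.length := by
  induction t generalizing l with
  | nil => exact ⟨(Steps.refl _ _).within.mono (by omega), le_rfl⟩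
  | cons c t ih =>
    obtain ⟨h₁, h₂⟩ := ih (P.run l c) fun c hc => ht c (List.mem_cons_of_mem _ hc)
    have hr := ht c List.mem_cons_self l
    refine ⟨(((steps_idle_later c).within.trans (within_run hP c [] o [] t l)).trans h₁).mono ?_,
      h₂.trans hr⟩
    have := Nat.mul_le_mul_left t.length
      (show 2 * (P.run l c).length + 3 ≤ 2 * l.length + 3 by omega)
    rw [List.length_cons, add_mul, one_mul]
    omega

/-- Letters are popped from the end of the word, so their commands come to lie in the order of the
word, below `mark`. -/
theorem within_move (i : List (Option X)) (o : List Bool) (t d : List P.Cmd) (l : List P.Γ) :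
    P.Within B (l.length + 1) .move (P.store i o t d l.reverse [])
      .idle (P.store i o t (P.mark :: (l.map P.comp ++ d)) [] []) := by
  induction l using List.reverseRecOn generalizing d with
  | nil => exact steps_move_nil.within
  | append_singleton l γ ih =>
    have h := ih (P.comp γ :: d)
    rw [List.reverse_append, List.map_append, List.append_assoc]
    exact ((steps_move_cons γ).within.trans h).mono (by simp; omega)

theorem within_clear (b : Bool) (i : List (Option X)) (o : List Bool) (t d : List P.Cmd)
    (l : List P.Γ) :
    P.Within B l.length (.clear b) (P.store i o t d l []) (.clear b) (P.store i o t d [] []) := by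
  induction l with
  | nil => exact (Steps.refl _ _).within
  | cons γ l ih => exact ((steps_clear_cons b γ).within.trans ih).mono (by simp; omega)

theorem within_answer (hP : P.Bounded B) (hmark : ∀ l, (P.run l P.mark).length ≤ l.length + 1)
    (hcomp : ∀ γ l, (P.run l (P.comp γ)).length ≤ l.length) (u v : List X) :
    P.Within B
      ((8 * (B + 2) ^ B + 17) * ((B + 2) ^ B + 1) ^ u.length * ((B + 2) ^ B + 1) ^ v.length)
      .idle (P.store (u.map some ++ none :: v.map some) [] [] [] [] [])
      (.clear (P.answer u v)) (P.store [] [] [] [] [] []) := by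
  obtain ⟨h₁, s₁⟩ := within_letters hP u (none :: v.map some) [] [] []
  have h₂ := within_move (P := P) (B := B) (v.map some) [] [] [] (P.eval u)
  obtain ⟨h₃, s₃⟩ := within_letters hP v [] [] (P.mark :: (P.eval u).map P.comp) []
  have h₄ := (steps_idle_later (o := []) (d := (P.eval u).map P.comp)
    (w := (P.eval v).reverse) (v := []) P.mark).within.trans
      (within_run hP P.mark [] [] [] ((P.eval u).map P.comp) (P.eval v))
  obtain ⟨h₅, s₅⟩ := within_later hP [] ((P.eval u).map P.comp) (P.run (P.eval v) P.mark)
    (by simpa using fun γ _ => hcomp γ)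
  have h₆ := (steps_idle_clear (P := P) (B := B) (o := []) (v := [])
    (w := (((P.eval u).map P.comp).foldl P.run (P.run (P.eval v) P.mark)).reverse)).within.trans
      (within_clear _ [] [] [] [] _)
  rw [List.head?_reverse] at h₆
  have hm := hmark (P.eval v)
  rw [List.append_nil] at h₂ h₃
  refine ((((((h₁.trans steps_idle_separator.within).trans h₂).trans h₃).trans h₄).trans
    h₅).trans h₆).mono ?_
  simp only [List.length_map, List.length_reverse, List.length_nil, zero_add, mul_one]
    at s₁ s₃ s₅ ⊢
  change (P.eval u).length + 1 ≤ _ at s₁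
  change (P.eval v).length + 1 ≤ _ at s₃
  generalize (B + 2) ^ B = M at *
  generalize (M + 1) ^ u.length = U at *
  generalize (M + 1) ^ v.length = V at *
  have e₁ : U ≤ U * V := Nat.le_mul_of_pos_right _ (by omega)
  have e₂ : V ≤ U * V := Nat.le_mul_of_pos_left _ (by omega)
  -- After `mark` the word has length at most `V`, and `2 * V + 3 ≤ 5 * V` because `V` is positive.
  have e₃ : (P.eval u).length * (2 * (P.run (P.eval v) P.mark).length + 3) ≤ U * (5 * V) :=
    Nat.mul_le_mul (by omega) (by omega)
  have e₄ : M * U ≤ M * (U * V) := Nat.mul_le_mul_left _ e₁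
  have e₅ : M * V ≤ M * (U * V) := Nat.mul_le_mul_left _ e₂
  have e₆ : (8 * M + 17) * U * V = 8 * (M * (U * V)) + 17 * (U * V) := by ring
  have e₇ : U * (5 * V) = 5 * (U * V) := by ring
  rw [mul_assoc 4 M U, mul_assoc 4 M V]
  omega

variable (P B) in
/-- The machine that executes a program. -/
def machine [Fintype X] [Fintype P.Γ] [Fintype P.Cmd] [Fintype P.β] [Fintype P.ρ] : FinTM2 where
  K := Stack
  k₀ := .inp
  k₁ := .out
  Γ := P.Sym
  Λ := Label P.Cmd P.β P.ρ
  main := .idle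
  σ := P.Reg
  initialState := (none, none, none, none)
  Γk₀Fin := inferInstanceAs (Fintype (Option X))
  m := P.stmt B

/-- A program that does not lengthen the word in its final phase is executed in exponential time. -/
theorem decidableInExpTime [Finite X] [Finite P.Γ] [Finite P.Cmd] [Finite P.β] [Finite P.ρ]
    (hmark : ∀ l, (P.run l P.mark).length ≤ l.length + 1)
    (hcomp : ∀ γ l, (P.run l (P.comp γ)).length ≤ l.length)
    {p : FreeSemigroup X × FreeSemigroup X → Prop}
    (hp : ∀ q, P.answer (q.1.head :: q.1.tail) (q.2.head :: q.2.tail) = true ↔ p q) :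
    DecidableInExpTime encodeWordPair p := by
  obtain ⟨B, hB⟩ := P.exists_bounded
  have := Fintype.ofFinite X
  have := Fintype.ofFinite P.Γ
  have := Fintype.ofFinite P.Cmd
  have := Fintype.ofFinite P.β
  have := Fintype.ofFinite P.ρ
  classical
  refine ⟨⟨⟨P.machine B, Equiv.refl (Option X), Equiv.refl Bool⟩,
    fun n => (8 * (B + 2) ^ B + 18) * ((B + 2) ^ B + 1) ^ n, fun q => Classical.choice ?_⟩,
    8 * (B + 2) ^ B + 18, (B + 2) ^ B + 1, fun n => le_rfl⟩
  obtain ⟨n, hn, h⟩ := within_answer hB hmark hcomp (q.1.head :: q.1.tail) (q.2.head :: q.2.tail)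
  obtain ⟨r, h⟩ := h (none, none, none, none)
  -- The additional step writes the answer and halts; it leads to no label and is therefore not
  -- covered by `Steps`.
  refine ⟨⟨⟨1 + n, ?_⟩, ?_⟩⟩
  · have hi : initList (P.machine B) (List.map (Equiv.refl (Option X)).invFun (encodeWordPair q)) =
        ⟨some .idle, (none, none, none, none), P.store ((q.1.head :: q.1.tail).map some ++
          none :: (q.2.head :: q.2.tail).map some) [] [] [] [] []⟩ := by
      refine congrArg (Cfg.mk _ _) (funext fun k => ?_)
      cases k with
      | inp => exact List.map_id _
      | _ => rfl
    have ho : haltList (P.machine B)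
        (List.map (Equiv.refl Bool).invFun (Computability.encodeBool (decide (p q)))) =
        ⟨none, (none, none, none, none), P.store [] [decide (p q)] [] [] [] []⟩ := by
      refine congrArg (Cfg.mk _ _) (funext fun k => ?_)
      cases k <;> rfl
    have ha : decide (p q) = P.answer (q.1.head :: q.1.tail) (q.2.head :: q.2.tail) := by
      rw [Bool.eq_iff_iff, decide_eq_true_iff, hp]
    rw [hi, Option.map_some, ho, Function.iterate_add_apply]
    refine (congrArg _ h).trans ?_
    rw [ha]
    exact congrArg some (stepAux_clear_nil (B := B) _ r)
  · change 1 + n ≤ _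
    have hl : (encodeWordPair q).length =
        (q.1.head :: q.1.tail).length + (q.2.head :: q.2.tail).length + 1 := by
      simp [encodeWordPair]; omega
    rw [hl, pow_succ, pow_add]
    generalize (B + 2) ^ B = M at *
    have hU : 1 ≤ (M + 1) ^ (q.1.head :: q.1.tail).length := Nat.one_le_pow _ _ (by omega)
    have hV : 1 ≤ (M + 1) ^ (q.2.head :: q.2.tail).length := Nat.one_le_pow _ _ (by omega)
    generalize (M + 1) ^ (q.1.head :: q.1.tail).length = U at *
    generalize (M + 1) ^ (q.2.head :: q.2.tail).length = V at *
    have e₁ : 1 ≤ U * V := Nat.mul_pos hU hV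
    rw [mul_assoc] at hn
    have e₂ : (8 * M + 18) * (U * V) ≤ (8 * M + 18) * (U * V * (M + 1)) :=
      Nat.mul_le_mul_left _ (Nat.le_mul_of_pos_right _ (by omega))
    have e₃ : (8 * M + 18) * (U * V) = (8 * M + 17) * (U * V) + U * V := by ring
    omega

end SweepProgram

/-! ### Two-tape automata: uniformization and reachable states -/

namespace DFA

variable {A Q : Type} (M : DFA (A ⊕ A) Q)

/-- A two-tape automaton, that reads the letters of the left word through `Sum.inl` and those of the
right word through `Sum.inr`, accepts a pair of words. -/
def Relates (l l' : List A) : Prop :=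
  ∃ z ∈ M.accepts, z.filterMap Sum.getLeft? = l ∧ z.filterMap Sum.getRight? = l'

/-- The states that lead into `G` by reading the letter `c` on the left. -/
def before (c : A) (G : Set Q) : Set Q :=
  {q | ∃ w : List A, M.evalFrom q (w.map Sum.inr ++ [Sum.inl c]) ∈ G}

/-- The states that lead to acceptance without reading on the left. -/
def beforeEnd : Set Q :=
  {q | ∃ w : List A, M.evalFrom q (w.map Sum.inr) ∈ M.accept}

/-- The states that lead to acceptance by reading `l` on the left. -/
def beforeWord (l : List A) : Set Q :=
  l.foldr M.before M.beforeEnd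

/-- Letters on the right that precede the next left letter are absorbed into the word `w` in the
definitions of `before` and `beforeEnd`. -/
theorem mem_beforeWord (z : List (A ⊕ A)) {q : Q} (h : M.evalFrom q z ∈ M.accept) :
    q ∈ M.beforeWord (z.filterMap Sum.getLeft?) := by
  induction z generalizing q with
  | nil => exact ⟨[], h⟩
  | cons s z ih =>
    have := ih (q := M.step q s) h
    cases s with
    | inl c => exact ⟨[], this⟩
    | inr b =>
      change q ∈ M.beforeWord (z.filterMap Sum.getLeft?)
      generalize z.filterMap Sum.getLeft? = l at this
      cases l with
      | nil => obtain ⟨w, hw⟩ := this; exact ⟨b :: w, hw⟩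
      | cons c l => obtain ⟨w, hw⟩ := this; exact ⟨b :: w, hw⟩

open Classical in
/-- A word read on the right on the way into `G` by reading `c` on the left. -/
noncomputable def wordBefore (c : A) (G : Set Q) (q : Q) : List A :=
  if h : q ∈ M.before c G then h.choose else []

open Classical in
/-- A word read on the right on the way to acceptance. -/
noncomputable def wordBeforeEnd (q : Q) : List A :=
  if h : q ∈ M.beforeEnd then h.choose else []

/-- The state reached after `wordBefore` and `c`. -/
noncomputable def stateAfter (c : A) (G : Set Q) (q : Q) : Q :=
  M.evalFrom q ((M.wordBefore c G q).map Sum.inr ++ [Sum.inl c])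

/-- A word related to the given word. -/
noncomputable def transduce : Q → List A → List A
  | q, [] => M.wordBeforeEnd q
  | q, c :: l => M.wordBefore c (M.beforeWord l) q ++
      transduce (M.stateAfter c (M.beforeWord l) q) l

theorem filterMap_getLeft?_map_inr (w : List A) :
    (w.map (Sum.inr : A → A ⊕ A)).filterMap Sum.getLeft? = [] := by
  induction w with simp_all

theorem filterMap_getRight?_map_inr (w : List A) :
    (w.map (Sum.inr : A → A ⊕ A)).filterMap Sum.getRight? = w := by
  induction w with simp_all

/-- The choices never get stuck: the block chosen before `c` leads, after `c`, to a state from which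
the rest of the input can be completed. -/
theorem exists_transduce (l : List A) {q : Q} (h : q ∈ M.beforeWord l) :
    ∃ z : List (A ⊕ A), M.evalFrom q z ∈ M.accept ∧ z.filterMap Sum.getLeft? = l ∧
      z.filterMap Sum.getRight? = M.transduce q l := by
  induction l generalizing q with
  | nil =>
    have h' : q ∈ M.beforeEnd := h
    refine ⟨(M.wordBeforeEnd q).map Sum.inr, ?_, filterMap_getLeft?_map_inr _,
      filterMap_getRight?_map_inr _⟩
    rw [wordBeforeEnd, dif_pos h']
    exact h'.choose_spec
  | cons c l ih =>
    have h' : q ∈ M.before c (M.beforeWord l) := h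
    have hs : M.stateAfter c (M.beforeWord l) q ∈ M.beforeWord l := by
      rw [stateAfter, wordBefore, dif_pos h']
      exact h'.choose_spec
    obtain ⟨z, h₁, h₂, h₃⟩ := ih hs
    refine ⟨(M.wordBefore c (M.beforeWord l) q).map Sum.inr ++ [Sum.inl c] ++ z, ?_, ?_, ?_⟩
    · rwa [evalFrom_of_append]
    · rw [List.filterMap_append, List.filterMap_append, filterMap_getLeft?_map_inr, h₂]
      rfl
    · rw [List.filterMap_append, List.filterMap_append, filterMap_getRight?_map_inr, h₃]
      simp [transduce]

/-- This is the uniformization: the output depends on `l` alone, and some output exists whenever `l`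
is in the domain of the relation. -/
theorem relates_transduce {l l' : List A} (h : M.Relates l l') :
    M.Relates l (M.transduce M.start l) := by
  obtain ⟨z, hz, rfl, -⟩ := h
  exact M.exists_transduce _ (M.mem_beforeWord z hz)

/-- The successors of the states in `E` by a letter on the left. -/
def stepLeft (E : Set Q) : Option A → Set Q
  | some d => (M.step · (Sum.inl d)) '' E
  | none => ∅

/-- The successors of the states in `E` by a letter on the right. -/
def stepRight (E : Set Q) : Option A → Set Q
  | some c => (M.step · (Sum.inr c)) '' E
  | none => ∅

/-- The states reached by reading `p` on the left and `r` on the right. -/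
def reach (p r : List A) : Set Q :=
  {q | ∃ z : List (A ⊕ A), z.filterMap Sum.getLeft? = p ∧ z.filterMap Sum.getRight? = r ∧
    M.eval z = q}

theorem relates_iff {l l' : List A} : M.Relates l l' ↔ ∃ q ∈ M.reach l l', q ∈ M.accept := by
  constructor
  · rintro ⟨z, hz, h₁, h₂⟩
    exact ⟨_, ⟨z, h₁, h₂, rfl⟩, hz⟩
  · rintro ⟨_, ⟨z, h₁, h₂, rfl⟩, hz⟩
    exact ⟨z, hz, h₁, h₂⟩

theorem stepLeft_reach_subset (p r : List A) (d : A) :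
    M.stepLeft (M.reach p r) (some d) ⊆ M.reach (p ++ [d]) r := by
  rintro _ ⟨_, ⟨z, rfl, rfl, rfl⟩, rfl⟩
  exact ⟨z ++ [Sum.inl d], by simp, by simp, by simp⟩

theorem stepRight_reach_subset (p r : List A) (c : A) :
    M.stepRight (M.reach p r) (some c) ⊆ M.reach p (r ++ [c]) := by
  rintro _ ⟨_, ⟨z, rfl, rfl, rfl⟩, rfl⟩
  exact ⟨z ++ [Sum.inr c], by simp, by simp, by simp⟩

/-- The cases are those of the last letter of an interleaving. All recurrences for `reach` follow
from them. -/
theorem mem_reach_cases {p r : List A} {q : Q} (h : q ∈ M.reach p r) :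
    (p = [] ∧ r = [] ∧ q = M.start) ∨
      (∃ p' d, p = p' ++ [d] ∧ q ∈ M.stepLeft (M.reach p' r) (some d)) ∨
      ∃ r' c, r = r' ++ [c] ∧ q ∈ M.stepRight (M.reach p r') (some c) := by
  obtain ⟨z, rfl, rfl, rfl⟩ := h
  induction z using List.reverseRecOn with
  | nil => exact Or.inl ⟨rfl, rfl, rfl⟩
  | append_singleton z s _ =>
    cases s with
    | inl d =>
      refine Or.inr (Or.inl ⟨z.filterMap Sum.getLeft?, d, by simp, M.eval z,
        ⟨z, rfl, by simp, rfl⟩, by simp⟩)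
    | inr c =>
      refine Or.inr (Or.inr ⟨z.filterMap Sum.getRight?, c, by simp, M.eval z,
        ⟨z, by simp, rfl, rfl⟩, by simp⟩)

theorem reach_nil_nil : M.reach [] [] = {M.start} := by
  ext q
  constructor
  · intro h
    rcases M.mem_reach_cases h with ⟨-, -, h⟩ | ⟨p', d, h, -⟩ | ⟨r', c, h, -⟩
    · exact h
    · simp at h
    · simp at h
  · rintro rfl
    exact ⟨[], rfl, rfl, rfl⟩

theorem reach_nil_append (r : List A) (c : A) :
    M.reach [] (r ++ [c]) = M.stepRight (M.reach [] r) (some c) := by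
  refine (M.stepRight_reach_subset _ _ _).antisymm' fun q h => ?_
  rcases M.mem_reach_cases h with ⟨-, h, -⟩ | ⟨p', d, h, -⟩ | ⟨r', c', h, hq⟩
  · simp at h
  · simp at h
  · obtain ⟨rfl, h'⟩ := List.append_inj' h rfl
    obtain rfl : c = c' := by simpa using h'
    exact hq

theorem reach_append_nil (p : List A) (d : A) :
    M.reach (p ++ [d]) [] = M.stepLeft (M.reach p []) (some d) := by
  refine (M.stepLeft_reach_subset _ _ _).antisymm' fun q h => ?_
  rcases M.mem_reach_cases h with ⟨h, -, -⟩ | ⟨p', d', h, hq⟩ | ⟨r', c', h, -⟩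
  · simp at h
  · obtain ⟨rfl, h'⟩ := List.append_inj' h rfl
    obtain rfl : d = d' := by simpa using h'
    exact hq
  · simp at h

/-- The local rule of the table: a cell is obtained from its two neighbours. -/
theorem reach_append_append (p r : List A) (d c : A) :
    M.reach (p ++ [d]) (r ++ [c]) = M.stepLeft (M.reach p (r ++ [c])) (some d) ∪
      M.stepRight (M.reach (p ++ [d]) r) (some c) := by
  refine (Set.union_subset (M.stepLeft_reach_subset _ _ _)
    (M.stepRight_reach_subset _ _ _)).antisymm' fun q h => ?_
  rcases M.mem_reach_cases h with ⟨h, -, -⟩ | ⟨p', d', h, hq⟩ | ⟨r', c', h, hq⟩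
  · simp at h
  · obtain ⟨rfl, h'⟩ := List.append_inj' h rfl
    obtain rfl : d = d' := by simpa using h'
    exact Or.inl hq
  · obtain ⟨rfl, h'⟩ := List.append_inj' h rfl
    obtain rfl : c = c' := by simpa using h'
    exact Or.inr hq

end DFA

/-! ### The sweep program of a family of two-tape automata -/

namespace RelationProgram

variable {A Q X : Type}

/-- The commands: replace a word by a word related to it by the automaton of a letter, attach to a
word the states reached by reading it on the right, and read a letter on the left. -/
inductive Command (A : Type)
  | apply : A → Command A
  | mark : Command A
  | read : Option A → Command A
  deriving Fintype

open Classical in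
/-- The program that computes words by the two-tape automata `M (some a)`, beginning with the words
`rep a`, and compares the results by the two-tape automaton `M none`. -/
noncomputable def program (M : Option A → DFA (A ⊕ A) Q) (rep : A → List A)
    (word : X → List A) : SweepProgram X where
  Γ := Option A × Set Q
  Cmd := Command A
  β := Set Q
  ρ := Option Q × Set Q
  word x := (word x).map .apply
  mark := .mark
  comp γ := .read γ.1
  backInit
    | .apply a => (M (some a)).beforeEnd
    | _ => ∅
  backStep
    | .apply a, (some c, _), G => (M (some a)).before c G
    | _, _, G => G
  fwdInit
    | .mark, _ => (none, {(M none).start})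
    | _, _ => (none, ∅)
  fwdStep
    | .apply a, (r, _), (some c, _), G =>
      ((some ((M (some a)).stateAfter c G (r.getD (M (some a)).start)), ∅),
        ((M (some a)).wordBefore c G (r.getD (M (some a)).start)).map fun b => (some b, ∅))
    | .apply _, r, (none, _), _ => (r, [])
    | .mark, (_, E), γ, _ => ((none, (M none).stepRight E γ.1), [(γ.1, E)])
    -- `γ.2` is the cell of the old row and `E` the contribution of the preceding cell of the new
    -- row; their combination is the new cell.
    | .read d, (_, E), γ, _ => ((none, (M none).stepRight ((M none).stepLeft γ.2 d ∪ E) γ.1),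
        [(γ.1, (M none).stepLeft γ.2 d ∪ E)])
  fwdEnd
    -- The state is still `none` only if the word is empty. The empty word stands for no element of
    -- the semigroup, so the first generator writes its own representative.
    | .apply a, (none, _) => (rep a).map fun b => (some b, ∅)
    | .apply a, (some q, _) => ((M (some a)).wordBeforeEnd q).map fun b => (some b, ∅)
    -- A row has one cell more than the word has letters; the last cell, which decides acceptance,
    -- sits on the extra letter `none`.
    | .mark, (_, E) => [(none, E)]
    | .read _, _ => []
  accept
    | some γ => decide (∃ q ∈ γ.2, q ∈ (M none).accept)
    | none => false

variable (M : Option A → DFA (A ⊕ A) Q) (rep : A → List A) (word : X → List A)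

/-- Words as words over the alphabet of the program. -/
def embed (l : List A) : List (Option A × Set Q) :=
  l.map fun b => (some b, ∅)

theorem length_run_mark (l : List (Option A × Set Q)) :
    ((program M rep word).run l .mark).length ≤ l.length + 1 := by
  have key : ∀ (l : List (Option A × Set Q)) (r : Option Q × Set Q),
      ((program M rep word).fwd .mark r l).length = l.length + 1 := by
    intro l
    induction l with
    | nil => intro r; rfl
    | cons γ l ih => intro r; exact congrArg Nat.succ (ih _)
  exact (key _ _).le

theorem length_run_read (d : Option A) (l : List (Option A × Set Q)) :
    ((program M rep word).run l (.read d)).length ≤ l.length := by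
  have key : ∀ (l : List (Option A × Set Q)) (r : Option Q × Set Q),
      ((program M rep word).fwd (.read d) r l).length = l.length := by
    intro l
    induction l with
    | nil => intro r; rfl
    | cons γ l ih => intro r; exact congrArg Nat.succ (ih _)
  exact (key _ _).le

theorem back_apply (a : A) (l : List A) :
    (program M rep word).back (.apply a) (embed l) = (M (some a)).beforeWord l := by
  induction l with
  | nil => rfl
  | cons c l ih => exact congrArg ((M (some a)).before c) ih

theorem run_apply (a : A) (l : List A) (hl : l ≠ []) :
    (program M rep word).run (embed l) (.apply a) =
      embed ((M (some a)).transduce (M (some a)).start l) := by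
  have key : ∀ (l : List A) (q : Q), (program M rep word).fwd (.apply a) (some q, ∅) (embed l) =
      embed ((M (some a)).transduce q l) := by
    intro l
    induction l with
    | nil => intro q; rfl
    | cons c l ih =>
      intro q
      change List.map _ _ ++ (program M rep word).fwd (.apply a) (some _, ∅) (embed l) = _
      rw [ih]
      simp only [embed, DFA.transduce, List.map_append, ← back_apply M rep word]
      rfl
  obtain ⟨c, l, rfl⟩ := List.exists_cons_of_ne_nil hl
  -- On a nonempty word the initial state `none` acts like `some` of the start state, by the default
  -- value of `getD`.
  exact key (c :: l) _

/-- The word `v` with the states reached by reading `p` on the left and, on the right, `r` and the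
part of `v` before a letter. -/
def row (M : DFA (A ⊕ A) Q) (p : List A) : List A → List A → List (Option A × Set Q)
  | r, [] => [(none, M.reach p r)]
  | r, c :: v => (some c, M.reach p r) :: row M p (r ++ [c]) v

theorem getLast?_row (M : DFA (A ⊕ A) Q) (p r v : List A) :
    (row M p r v).getLast? = some (none, M.reach p (r ++ v)) := by
  induction v generalizing r with
  | nil => simp [row]
  | cons c v ih =>
    rw [row, List.getLast?_cons, ih]
    simp

theorem run_mark (v : List A) :
    (program M rep word).run (embed v) .mark = row (M none) [] [] v := by
  have key : ∀ (v r : List A), (program M rep word).fwd .mark (none, (M none).reach [] r)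
      (embed v) = row (M none) [] r v := by
    intro v
    induction v with
    | nil => intro r; rfl
    | cons c v ih =>
      intro r
      rw [row, ← ih, DFA.reach_nil_append]
      rfl
  rw [← key, DFA.reach_nil_nil]
  rfl

/-- The induction carries along the row the part `E` of the next cell that comes from reading on the
right. It is empty in the first column, by `reach_append_nil`; afterwards `reach_append_append`
applies. -/
theorem run_read (d : A) (p v : List A) :
    (program M rep word).run (row (M none) p [] v) (.read (some d)) =
      row (M none) (p ++ [d]) [] v := by
  have key : ∀ (v r : List A) (E : Set Q), (M none).reach (p ++ [d]) r =
      (M none).stepLeft ((M none).reach p r) (some d) ∪ E →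
      (program M rep word).fwd (.read (some d)) (none, E) (row (M none) p r v) =
        row (M none) (p ++ [d]) r v := by
    intro v
    induction v with
    | nil =>
      intro r E h
      rw [row, row, h]
      rfl
    | cons c v ih =>
      intro r E h
      rw [row, row, ← ih _ _ ((M none).reach_append_append p r d c), h]
      rfl
  exact key v [] ∅ (by rw [DFA.reach_append_nil, Set.union_empty])

theorem foldl_run_read (u p v : List A) :
    ((embed u).map (program M rep word).comp).foldl (program M rep word).run
      (row (M none) p [] v) = row (M none) (p ++ u) [] v := by
  induction u generalizing p with
  | nil => rw [List.append_nil]; rfl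
  | cons d u ih =>
    have h := ih (p ++ [d])
    rw [List.append_assoc] at h
    refine Eq.trans ?_ h
    rw [← run_read M rep word]
    rfl

theorem answer_iff {u v : List X} {l l' : List A} (hu : (program M rep word).eval u = embed l)
    (hv : (program M rep word).eval v = embed l') :
    (program M rep word).answer u v = true ↔ (M none).Relates l l' := by
  have h₁ := run_mark M rep word l'
  have h₂ := foldl_run_read M rep word l [] l'
  rw [← h₁] at h₂
  have h₃ := getLast?_row (M none) ([] ++ l) [] l'
  rw [← h₂] at h₃
  rw [DFA.relates_iff, SweepProgram.answer, hu, hv]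
  refine (Eq.congr_left (congrArg (program M rep word).accept h₃)).trans ?_
  exact @decide_eq_true_iff _ (Classical.propDecidable _)

end RelationProgram

namespace RelationProgram

variable {X : Type*}

/-- The letters of a word. -/
def letters (w : FreeSemigroup X) : List X :=
  w.head :: w.tail

theorem letters_mul (w w' : FreeSemigroup X) : letters (w * w') = letters w ++ letters w' := rfl

theorem letters_ne_nil (w : FreeSemigroup X) : letters w ≠ [] :=
  List.cons_ne_nil _ _

end RelationProgram

/-! ### Computing representatives of products and deciding equality -/

namespace RelationProgram

variable {A Q X : Type} {S : Type*} [Semigroup S] (M : Option A → DFA (A ⊕ A) Q)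
  (rep : A → List A) (wd : X → FreeSemigroup A) (γ : A → S) (ν : List A → S → Prop)

/-- The two-tape automata `M (some a)` compute right multiplication by the generators `γ a` on
nonempty words that represent the elements of `S` by `ν`. -/
structure Computes : Prop where
  rep : ∀ a, ν (rep a) (γ a)
  ne_nil : ∀ l s, ν l s → l ≠ []
  exists_relates : ∀ a l s, ν l s → ∃ l', (M (some a)).Relates l l'
  mul : ∀ a l l' s, ν l s → (M (some a)).Relates l l' → ν l' (s * γ a)

variable {M rep γ ν}

theorem Computes.foldl_run (h : Computes M rep γ ν) (w : FreeSemigroup A) {l : List A} {s : S}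
    (hl : ν l s) : ∃ l', ((letters w).map Command.apply).foldl
      (program M rep fun x => letters (wd x)).run (embed l) = embed l' ∧
      ν l' (s * FreeSemigroup.lift γ w) := by
  induction w using FreeSemigroup.recOnMul generalizing l s with
  | ih1 a =>
    obtain ⟨l', hl'⟩ := h.exists_relates a l s hl
    exact ⟨_, run_apply M rep _ a l (h.ne_nil l s hl),
      h.mul a l _ s hl ((M (some a)).relates_transduce hl')⟩
  | ih2 a w ih₁ ih₂ =>
    obtain ⟨l₁, e₁, h₁⟩ := ih₁ hl
    obtain ⟨l₂, e₂, h₂⟩ := ih₂ h₁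
    refine ⟨l₂, ?_, ?_⟩
    · rw [letters_mul, List.map_append]
      exact List.foldl_append.trans ((congrArg (fun l => List.foldl
        (program M rep fun x => letters (wd x)).run l _) e₁).trans e₂)
    · rwa [map_mul, ← mul_assoc]

/-- Without an identity element the empty word has no value, so the first letter is treated by `rep`
and the remaining ones by `Computes.foldl_run`. -/
theorem Computes.foldl_run_nil (h : Computes M rep γ ν) (w : FreeSemigroup A) :
    ∃ l', ((letters w).map Command.apply).foldl
      (program M rep fun x => letters (wd x)).run [] = embed l' ∧
      ν l' (FreeSemigroup.lift γ w) := by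
  induction w using FreeSemigroup.recOnMul with
  | ih1 a => exact ⟨rep a, rfl, h.rep a⟩
  | ih2 a w ih₁ _ =>
    obtain ⟨l₁, e₁, h₁⟩ := ih₁
    obtain ⟨l₂, e₂, h₂⟩ := h.foldl_run wd w h₁
    refine ⟨l₂, ?_, ?_⟩
    · rw [letters_mul, List.map_append]
      exact List.foldl_append.trans ((congrArg (fun l => List.foldl
        (program M rep fun x => letters (wd x)).run l _) e₁).trans e₂)
    · rwa [map_mul]

/-- The word over `A` that replaces a word over `X`. -/
def substitute : FreeSemigroup X →ₙ* FreeSemigroup A :=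
  FreeSemigroup.lift wd

theorem letters_substitute (u : FreeSemigroup X) :
    (letters u).flatMap (fun x => (letters (wd x)).map Command.apply) =
      (letters (substitute wd u)).map Command.apply := by
  induction u using FreeSemigroup.recOnMul with
  | ih1 x => exact List.append_nil _
  | ih2 x w ih₁ ih₂ =>
    rw [letters_mul, List.flatMap_append, ih₁, ih₂, map_mul, letters_mul, List.map_append]

theorem Computes.exists_eval (h : Computes M rep γ ν) {g : X → S}
    (hg : ∀ x, FreeSemigroup.lift γ (wd x) = g x) (u : FreeSemigroup X) :
    ∃ l, (program M rep fun x => letters (wd x)).eval (letters u) = embed l ∧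
      ν l (FreeSemigroup.lift g u) := by
  obtain ⟨l, e, hl⟩ := h.foldl_run_nil wd (substitute wd u)
  refine ⟨l, ?_, ?_⟩
  · rw [← e, ← letters_substitute]
    rfl
  · have : (FreeSemigroup.lift γ).comp (substitute wd) = FreeSemigroup.lift g :=
      FreeSemigroup.hom_ext (funext hg)
    rwa [← this]

/-- The word problem is decided in exponential time if two-tape automata compute products and
compare words. -/
theorem Computes.decidableInExpTime [Finite A] [Finite Q] [Finite X] (h : Computes M rep γ ν)
    (heq : ∀ l l' s s', ν l s → ν l' s' → ((M none).Relates l l' ↔ s = s')) {g : X → S}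
    (hg : ∀ x, FreeSemigroup.lift γ (wd x) = g x) :
    DecidableInExpTime encodeWordPair (WordProblem g) := by
  have := Fintype.ofFinite A
  let P := program M rep fun x => letters (wd x)
  have : Inhabited P.Γ := ⟨((none, ∅) : Option A × Set Q)⟩
  have : Finite P.Γ := inferInstanceAs (Finite (Option A × Set Q))
  have : Finite P.Cmd := inferInstanceAs (Finite (Command A))
  have : Finite P.β := inferInstanceAs (Finite (Set Q))
  have : Finite P.ρ := inferInstanceAs (Finite (Option Q × Set Q))
  refine P.decidableInExpTime (length_run_mark M rep _)
    (fun γ l => length_run_read M rep _ γ.1 l) fun q => ?_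
  obtain ⟨l, e, hl⟩ := h.exists_eval wd hg q.1
  obtain ⟨l', e', hl'⟩ := h.exists_eval wd hg q.2
  exact (answer_iff M rep _ e e').trans (heq _ _ _ _ hl hl')

end RelationProgram

/-- Finitely many regular languages are accepted by automata with the same set of states. -/
theorem Language.exists_dfa_of_isRegular {ι α : Type} [Finite ι] (K : ι → Language α)
    (hK : ∀ i, (K i).IsRegular) :
    ∃ (Q : Type) (_ : Finite Q) (M : ι → DFA α Q), ∀ i, (M i).accepts = K i := by
  choose Q hQ M hM using hK
  -- All automata run in parallel on the product of their state sets; only the accepting set depends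
  -- on `i`.
  refine ⟨∀ i, Q i, inferInstance, fun i =>
    ⟨fun q a j => (M j).step (q j) a, fun j => (M j).start, {q | q i ∈ (M i).accept}⟩,
    fun i => ?_⟩
  rw [← hM]
  ext z
  have key : ∀ (z : List α) (q : ∀ j, Q j),
      z.foldl (fun q a j => (M j).step (q j) a) q = fun j => (M j).evalFrom (q j) z := by
    intro z
    induction z with
    | nil => intro q; rfl
    | cons a z ih => intro q; exact ih _
  change (z.foldl (fun q a j => (M j).step (q j) a) _) i ∈ (M i).accept ↔ _
  rw [key]
  rfl

/-! ### From rational relations to two-tape automata -/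

namespace RelationProgram

variable {A : Type} {B : Type*}

/-- The pair of words over `B` that is interleaved in a word over `A ⊕ A`. -/
def untangle (e : A → B) : FreeMonoid (A ⊕ A) →* FreeMonoid B × FreeMonoid B :=
  FreeMonoid.lift (Sum.elim (fun a => (FreeMonoid.of (e a), 1)) fun a => (1, FreeMonoid.of (e a)))

theorem untangle_apply (e : A → B) (z : List (A ⊕ A)) :
    untangle e (FreeMonoid.ofList z) =
      (FreeMonoid.ofList ((z.filterMap Sum.getLeft?).map e),
        FreeMonoid.ofList ((z.filterMap Sum.getRight?).map e)) := by
  induction z with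
  | nil => exact map_one _
  | cons s z ih =>
    rw [FreeMonoid.ofList_cons, map_mul, ih, untangle, FreeMonoid.lift_eval_of]
    cases s <;> rfl

/-- Write the left word before the right one. Surjectivity is what allows a rational relation to be
lifted to a regular language of interleavings. -/
theorem untangle_surjective (e : A ≃ B) : Function.Surjective (untangle e) := by
  rintro ⟨x, y⟩
  refine ⟨FreeMonoid.ofList ((x.toList.map fun b => Sum.inl (e.symm b)) ++
    y.toList.map fun b => Sum.inr (e.symm b)), ?_⟩
  rw [untangle_apply]
  have h₁ : ∀ w : List B, (w.map fun b => (Sum.inl (e.symm b) : A ⊕ A)).filterMap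
      Sum.getLeft? = w.map e.symm := fun w => by induction w with simp_all
  have h₂ : ∀ w : List B, (w.map fun b => (Sum.inl (e.symm b) : A ⊕ A)).filterMap
      Sum.getRight? = [] := fun w => by induction w with simp_all
  have h₃ : ∀ w : List B, (w.map fun b => (Sum.inr (e.symm b) : A ⊕ A)).filterMap
      Sum.getLeft? = [] := fun w => by induction w with simp_all
  have h₄ : ∀ w : List B, (w.map fun b => (Sum.inr (e.symm b) : A ⊕ A)).filterMap
      Sum.getRight? = w.map e.symm := fun w => by induction w with simp_all
  simp [h₁, h₂, h₃, h₄]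

/-- A rational relation is accepted by a two-tape automaton. -/
theorem relates_iff_of_image_untangle (e : A ≃ B) {Q : Type} {M : DFA (A ⊕ A) Q}
    {R : Set (FreeSemigroup B × FreeSemigroup B)}
    (h : untangle e '' (M.accepts : Set (FreeMonoid (A ⊕ A))) =
      Prod.map FreeSemigroup.toFreeMonoid FreeSemigroup.toFreeMonoid '' R) (l l' : List A) :
    M.Relates l l' ↔ ∃ p ∈ R, letters p.1 = l.map e ∧ letters p.2 = l'.map e := by
  have h₁ : M.Relates l l' ↔ (FreeMonoid.ofList (l.map e), FreeMonoid.ofList (l'.map e)) ∈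
      untangle e '' (M.accepts : Set (FreeMonoid (A ⊕ A))) := by
    constructor
    · rintro ⟨z, hz, rfl, rfl⟩
      exact ⟨FreeMonoid.ofList z, hz, untangle_apply e z⟩
    · rintro ⟨z, hz, hzl⟩
      have hz' := (untangle_apply e z.toList).symm.trans hzl
      rw [Prod.mk.injEq, EmbeddingLike.apply_eq_iff_eq, EmbeddingLike.apply_eq_iff_eq] at hz'
      exact ⟨z, hz, List.map_injective_iff.2 e.injective hz'.1,
        List.map_injective_iff.2 e.injective hz'.2⟩
  rw [h₁, h]
  have ht : ∀ w : FreeSemigroup B, FreeSemigroup.toFreeMonoid w = FreeMonoid.ofList (letters w) :=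
    fun w => FreeSemigroup.toFreeMonoid_mk_eq_cons _ _
  simp only [Set.mem_image, Prod.map, ht, Prod.mk.injEq, EmbeddingLike.apply_eq_iff_eq]

end RelationProgram

open RelationProgram in
theorem mainTheorem5 {S : Type*} [Semigroup S] (hS : IsQuasiAutomatic S)
    {X : Type} [Finite X] (g : X → S) (hg : Subsemigroup.closure (Set.range g) = ⊤) :
    DecidableInExpTime encodeWordPair (WordProblem g) := by
  obtain ⟨Q⟩ := hS
  -- The alphabets of the machine must lie in `Type`, whereas `S` may lie in any universe; so the
  -- generators are renamed by `Fin n`.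
  obtain ⟨n, ⟨e'⟩⟩ := Finite.exists_equiv_fin Q.A
  let e : Fin n ≃ Q.A := e'.symm
  have hK : ∀ i : Option (Fin n), ∃ K : Language (Fin n ⊕ Fin n), K.IsRegular ∧
      untangle e '' (K : Set (FreeMonoid (Fin n ⊕ Fin n))) =
        Prod.map FreeSemigroup.toFreeMonoid FreeSemigroup.toFreeMonoid ''
          (i.elim Q.R fun a => Q.Rgen (e a)) := by
    rintro (_ | a)
    · exact Q.rational_R.exists_isRegular _ (untangle_surjective e)
    · exact (Q.rational_Rgen (e a)).exists_isRegular _ (untangle_surjective e)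
  choose K hK hR using hK
  obtain ⟨σ, _, M, hM⟩ := Language.exists_dfa_of_isRegular K hK
  have hrel : ∀ i l l', (M i).Relates l l' ↔
      ∃ p ∈ i.elim Q.R fun a => Q.Rgen (e a), letters p.1 = l.map e ∧ letters p.2 = l'.map e :=
    fun i => relates_iff_of_image_untangle e (by rw [hM, hR])
  have hL : ∀ s, ∃ w ∈ Q.L, FreeSemigroup.lift (Subtype.val : Q.A → S) w = s := fun s =>
    Q.image_L.ge (Set.mem_univ s)
  have hpre : ∀ w : FreeSemigroup Q.A, ((letters w).map e.symm).map e = letters w := fun w => by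
    simp
  have hinj : ∀ w w' : FreeSemigroup Q.A, letters w = letters w' → w = w' := by
    rintro ⟨x, l⟩ ⟨y, l'⟩ h
    obtain ⟨rfl, rfl⟩ := List.cons.inj h
    rfl
  let γ : Fin n → S := fun a => e a
  -- An element may have many representatives in `L`; the program only has to stay within `L`, and
  -- `R` compares any two of them.
  let ν : List (Fin n) → S → Prop := fun l s =>
    ∃ w ∈ Q.L, FreeSemigroup.lift (Subtype.val : Q.A → S) w = s ∧ letters w = l.map e
  choose ω hωL hω using hL
  have hcomp : Computes M (fun a => (letters (ω (γ a))).map e.symm) γ ν := by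
    refine ⟨fun a => ⟨ω (γ a), hωL _, hω _, (hpre _).symm⟩, ?_, ?_, ?_⟩
    · rintro l s ⟨w, -, -, hw⟩ rfl
      exact letters_ne_nil w hw
    · rintro a l s ⟨w, hwL, rfl, hw⟩
      -- Each relation of multiplication is total on `L` because `L` maps onto `S`.
      refine ⟨(letters (ω _)).map e.symm, (hrel _ _ _).2
        ⟨(w, ω (FreeSemigroup.lift (Subtype.val : Q.A → S) (w * FreeSemigroup.of (e a)))),
          ?_, hw, (hpre _).symm⟩⟩
      rw [Option.elim_some, Q.Rgen_eq]
      exact ⟨hwL, hωL _, (hω _).symm⟩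
    · rintro a l l' s ⟨w, hwL, rfl, hw⟩ h
      obtain ⟨p, hp, h₁, h₂⟩ := (hrel _ _ _).1 h
      rw [Option.elim_some, Q.Rgen_eq] at hp
      obtain ⟨-, hpL, hp⟩ := hp
      obtain rfl := hinj _ _ (hw.trans h₁.symm)
      exact ⟨p.2, hpL, by rw [← hp, map_mul, FreeSemigroup.lift_of], h₂⟩
  -- Each letter `x` of the given alphabet is replaced by a fixed word of `L` that represents `g x`.
  refine hcomp.decidableInExpTime
    (fun x => FreeSemigroup.map e.symm (ω (g x))) ?_ fun x => ?_
  · rintro l l' _ _ ⟨w, hwL, rfl, hw⟩ ⟨w', hwL', rfl, hw'⟩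
    rw [hrel, Option.elim_none, Q.R_eq]
    constructor
    · rintro ⟨p, ⟨-, -, hp⟩, h₁, h₂⟩
      rwa [hinj _ _ (hw.trans h₁.symm), hinj _ _ (hw'.trans h₂.symm)]
    · intro h
      exact ⟨(w, w'), ⟨hwL, hwL', h⟩, hw, hw'⟩
  · have hc : (FreeSemigroup.lift γ).comp (FreeSemigroup.map e.symm) =
        FreeSemigroup.lift (Subtype.val : Q.A → S) :=
      FreeSemigroup.hom_ext (funext fun a => congrArg Subtype.val (e.apply_symm_apply a))
    exact (DFunLike.congr_fun hc (ω (g x))).trans (hω (g x))
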